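/- A priced timed Petri net (PTPN) has a finite set $Q$ of control states, a finite set $P$ of places, a finite set $T$ of transitions, and an integer cost function $\mathrm{Cost}\colon P\cup T\to\mathbb Z$. A transition is a tuple $(q_1,q_2,\mathrm{In},\mathrm{Read},\mathrm{Out})$ with $q_1,q_2\in Q$ and finite multisets $\mathrm{In},\mathrm{Read},\mathrm{Out}$ over $P\times\mathrm{Intrv}$, where $\mathrm{Intrv}$ is the set of open, closed and half-open intervals with left end in $\mathbb N$ and right end in $\mathbb N\cup\{\infty\}$. A configuration $(q,M)$ consists of a control state and a finite multiset $M$ of tokens $(p,x)\in P\times\mathbb R_{\ge 0}$ (place and age). A timed transition increases the ages of all tokens by some $x>0$ and costs $x\cdot\sum_{p\in P}|M(p)|\cdot\mathrm{Cost}(p)$. A discrete transition $t$ leads from $(q_1,I+R+M')$ to $(q_2,O+R+M')$ if the tokens of $I$, $R$, $O$ can be matched bijectively with the arcs in $\mathrm{In}$, $\mathrm{Read}$, $\mathrm{Out}$, respecting places and with ages in the respective intervals; it costs $\mathrm{Cost}(t)$. The cost of a computation (a finite sequence of transitions) is the sum of the costs of its transitions. In the discrete-time semantics, delays and the ages of new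 tokens are required to be natural numbers. Given a PTPN, control states $q_{\mathrm{init}},q_{\mathrm{fin}}$ and $v\in\mathbb N$, consider all computations from $q_{\mathrm{init}}$ with the empty marking to $q_{\mathrm{fin}}$ with an arbitrary marking. The cost-threshold problem asks whether the infimum of their costs in $[-\infty,\infty]$ (which is $+\infty$ if there is no such computation) is at most $v$. The zero-cost reachability problem asks whether one of these computations has cost exactly $0$. Theorem. If negative transition costs are allowed, then the cost-threshold problem and the zero-cost reachability problem for PTPN are undecidable. This holds both for continuous time and for discrete time, and it holds already when all place costs are non-negative, all transition costs are non-positive and $v=0$. That is, for every class $\mathcal C$ of instances that contains all instances with these three restrictions, in either semantics and for either problem, no total computable function answers the problem correctly on all instances in $\mathcal C$. -/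

import Mathlib

open scoped NNReal

namespace PTPN

/-! ## Syntax of priced timed Petri nets -/

/-- Intervals `[w:z]`, `(w:z]`, `[w:z)`, `(w:z)` with `w ∈ ℕ` and `z ∈ ℕ ∪ {∞}`.  A finite right
end `z` comes with a flag that says whether it belongs to the interval; `none` is `∞`. -/
structure Interval where
  lower : ℕ
  lowerClosed : Bool
  upper : Option (ℕ × Bool)

/-- `x` lies in the interval. -/
def Interval.Mem (J : Interval) (x : ℝ≥0) : Prop :=
  (if J.lowerClosed then (J.lower : ℝ≥0) ≤ x else (J.lower : ℝ≥0) < x) ∧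
    match J.upper with
    | none => True
    | some (z, true) => x ≤ (z : ℝ≥0)
    | some (z, false) => x < (z : ℝ≥0)

/-- A transition `(q₁, q₂, In, Read, Out)`. -/
structure Transition (Q P : Type) where
  source : Q
  target : Q
  input : Multiset (P × Interval)
  read : Multiset (P × Interval)
  output : Multiset (P × Interval)

/-- Renaming of the control states and places of a transition. -/
def Transition.map {Q P Q' P' : Type} (f : Q → Q') (g : P → P') (t : Transition Q P) :
    Transition Q' P' where
  source := f t.source
  target := f t.target
  input := t.input.map (Prod.map g id)
  read := t.read.map (Prod.map g id)
  output := t.output.map (Prod.map g id)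

/-- A priced timed Petri net with control states `Q`, places `P`, a finite set of transitions,
and integer (possibly negative) costs of places and transitions. -/
structure Net (Q P : Type) where
  trans : Finset (Transition Q P)
  placeCost : P → ℤ
  transCost : {t // t ∈ trans} → ℤ

/-! ## Semantics -/

/-- A marking: a finite multiset of tokens, each given by its place and its age. -/
abbrev Marking (P : Type) : Type := Multiset (P × ℝ≥0)

/-- A configuration: a control state and a marking. -/
abbrev Config (Q P : Type) : Type := Q × Marking P

/-- `match(M, α)`: a bijection between the tokens of `M` and the arcs of `α` that respects places
and puts the age of each token into the interval of its arc. -/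
def Matches {P : Type} (M : Marking P) (α : Multiset (P × Interval)) : Prop :=
  Multiset.Rel (fun token arc => token.1 = arc.1 ∧ arc.2.Mem token.2) M α

/-- `M^{+x}`: all tokens become older by `x`. -/
def Marking.delay {P : Type} (M : Marking P) (x : ℝ≥0) : Marking P :=
  M.map fun token => (token.1, token.2 + x)

/-- The set of time values: dense time. -/
def denseTime : Set ℝ≥0 := Set.univ

/-- The set of time values: discrete time. -/
def discreteTime : Set ℝ≥0 := Set.range ((↑) : ℕ → ℝ≥0)

namespace Net

variable {Q P : Type}

/-- Storage cost of a marking per time unit: every token costs as much as its place, which makes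
`∑ p, |M(p)| * Cost(p)` in total. -/
def storageCost (N : Net Q P) (M : Marking P) : ℤ :=
  (M.map fun token => N.placeCost token.1).sum

/-- `N.Step D c c' r`: a single timed or discrete transition of cost `r` from `c` to `c'`, where
delays and the ages of new tokens are taken from the set `D` of time values. -/
inductive Step (N : Net Q P) (D : Set ℝ≥0) : Config Q P → Config Q P → ℝ → Prop
  | time (q : Q) (M : Marking P) (x : ℝ≥0) (pos : 0 < x) (mem : x ∈ D) :
      Step N D (q, M) (q, M.delay x) ((x : ℝ) * (N.storageCost M : ℝ))
  | fire (t : {t // t ∈ N.trans}) (I R O rest : Marking P)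
      (input : Matches I t.1.input) (read : Matches R t.1.read) (output : Matches O t.1.output)
      (mem : ∀ token ∈ O, token.2 ∈ D) :
      Step N D (t.1.source, I + R + rest) (t.1.target, O + R + rest) (N.transCost t : ℝ)

/-- `N.Computation D c c' r`: some computation, a finite sequence of transitions, leads from `c`
to `c'` and has total cost `r`. -/
inductive Computation (N : Net Q P) (D : Set ℝ≥0) : Config Q P → Config Q P → ℝ → Prop
  | nil (c : Config Q P) : Computation N D c c 0
  | cons {c c' c'' : Config Q P} {r s : ℝ} (step : Step N D c c' r)
      (rest : Computation N D c' c'' s) : Computation N D c c'' (r + s)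

/-- The costs of all computations from control state `init` and the empty marking to control
state `fin` and an arbitrary marking. -/
def costs (N : Net Q P) (D : Set ℝ≥0) (init fin : Q) : Set ℝ :=
  {r | ∃ M : Marking P, N.Computation D (init, 0) (fin, M) r}

/-- The infimum of these costs: `⊤` if there is no such computation, `⊥` if the costs are
unbounded below. -/
noncomputable def optCost (N : Net Q P) (D : Set ℝ≥0) (init fin : Q) : EReal :=
  sInf ((fun r : ℝ => (r : EReal)) '' N.costs D init fin)

end Net

/-! ## Problems and decidability -/

/-- An instance: a net with finitely many control states and places, the initial and the final
control state, and a threshold. -/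
structure Instance where
  numStates : ℕ
  numPlaces : ℕ
  net : Net (Fin numStates) (Fin numPlaces)
  init : Fin numStates
  fin : Fin numStates
  threshold : ℕ

/-- The cost-threshold problem: is the optimal cost at most the threshold? -/
def CostThreshold (D : Set ℝ≥0) (I : Instance) : Prop :=
  I.net.optCost D I.init I.fin ≤ ((I.threshold : ℝ) : EReal)

/-- Is the final control state reachable by a computation of total cost zero? -/
def ZeroCostReachable (D : Set ℝ≥0) (I : Instance) : Prop :=
  (0 : ℝ) ∈ I.net.costs D I.init I.fin

def Interval.equivProd : Interval ≃ ℕ × Bool × Option (ℕ × Bool) where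
  toFun J := (J.lower, J.lowerClosed, J.upper)
  invFun c := ⟨c.1, c.2.1, c.2.2⟩
  left_inv _ := rfl
  right_inv _ := rfl

instance : Primcodable Interval := Primcodable.ofEquiv _ Interval.equivProd

/-- Finite data for a transition and its cost: source, target, lists of the input, read and output
arcs, and the cost.  States and places are numbers. -/
abbrev TransitionCode : Type :=
  ℕ × ℕ × List (ℕ × Interval) × List (ℕ × Interval) × List (ℕ × Interval) × ℤ

def TransitionCode.transition : TransitionCode → Transition ℕ ℕ
  | (q₁, q₂, inp, rd, out, _) => ⟨q₁, q₂, inp, rd, out⟩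

def TransitionCode.cost : TransitionCode → ℤ
  | (_, _, _, _, _, k) => k

/-- Finite data for an instance, the input of an algorithm: the number of control states, the list
of the place costs, a list of the transitions with their costs, the initial and the final control
state, and the threshold. -/
abbrev InstanceCode : Type :=
  ℕ × List ℤ × List TransitionCode × ℕ × ℕ × ℕ

/-- The code describes the instance: its list of transitions runs through the set of transitions
of the net without repetition, and all other data agree. -/
def Represents : InstanceCode → Instance → Prop
  | (n, placeCosts, ts, q₀, q₁, v), I =>
    n = I.numStates ∧
    placeCosts = List.ofFn I.net.placeCost ∧
    (ts.map TransitionCode.transition : Multiset (Transition ℕ ℕ)) =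
      I.net.trans.val.map (Transition.map Fin.val Fin.val) ∧
    (∀ e ∈ ts, ∀ t : {t // t ∈ I.net.trans},
      TransitionCode.transition e = t.1.map Fin.val Fin.val →
        TransitionCode.cost e = I.net.transCost t) ∧
    q₀ = I.init.val ∧ q₁ = I.fin.val ∧ v = I.threshold

/-- The problem `A` is decidable on the class `C` of instances: some total computable function
answers it correctly on every code of every instance in `C`. -/
def DecidableOn (C : Set Instance) (A : Instance → Prop) : Prop :=
  ∃ f : InstanceCode → Bool, Computable f ∧
    ∀ I ∈ C, ∀ c : InstanceCode, Represents c I → (f c = true ↔ A I)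

/-- The instances with non-negative place costs, non-positive transition costs and threshold
zero. -/
def restricted : Set Instance :=
  {I | (∀ p, 0 ≤ I.net.placeCost p) ∧ (∀ t, I.net.transCost t ≤ 0) ∧ I.threshold = 0}

end PTPN

namespace PTPN

/-! ## Nondeterministic counter machines -/

/-! The proof reduces the halting problem on input zero to both problems at once. Some counter
machine, started with a program code in register zero and all other registers empty, can reach its
final state exactly when the program halts: it guesses an amount of fuel, evaluates the primitive
recursive predicate `haltsWithin`, and accepts if the value is not zero. This rests on counter
machines being closed under composition and iteration (`Realizable.comp`, `Realizable.star`) and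
hence computing every primitive recursive function (`Computes.of_primrec`).

The net stores registers as numbers of tokens and has one further token, the clock. Every place
costs one, every produced token has age zero, and every transition pays back the ages it consumes.
Hence the cost of a computation from the empty marking is the total age of its final marking
(`Net.IsRefund.totalAge_computation`); it is never negative, and it is zero exactly if all final
tokens have age zero.

Ordinary instructions fire only at clock age zero. A test for zero of register `i` fires at clock
age one and resets the clock, so all other tokens are then one unit too old. Afterwards tokens of
age one may be renewed, except those at the place of `i`. If the register was empty, everything can
be repaired for free. If not, some token stays ahead of the clock by at least one forever:
decrements take only tokens of age zero and renewals only tokens of age one, with the clock at zero.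
A cheating run therefore costs at least one (`Inv.step`, `exists_reach_of_costs`), while an honest
run costs zero (`zero_mem_costs`). As the clock is always consumed at an integer age, tokens differ
in age from it by integers even in dense time. The gap between zero and one settles the infimum as
well as exact cost zero. -/

/-- The instructions of a counter machine with registers indexed by `ℕ`. -/
inductive Act
  | nop
  | inc (i : ℕ)
  | dec (i : ℕ)
  | zero (i : ℕ)

/-- The effect of an instruction on the registers: `dec` blocks on an empty register, `zero` blocks
on a nonempty one. -/
def Act.Run : Act → (ℕ → ℕ) → (ℕ → ℕ) → Prop
  | nop, s, s' => s' = s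
  | inc i, s, s' => s' = Function.update s i (s i + 1)
  | dec i, s, s' => s i ≠ 0 ∧ s' = Function.update s i (s i - 1)
  | zero i, s, s' => s i = 0 ∧ s' = s

/-- A single step of the machine with instruction set `T`. -/
def MStep {σ : Type} (T : Set (σ × Act × σ)) (c c' : σ × (ℕ → ℕ)) : Prop :=
  ∃ x, (c.1, x, c'.1) ∈ T ∧ x.Run c.2 c'.2

/-- Reachability in the machine with instruction set `T`. -/
abbrev MReach {σ : Type} (T : Set (σ × Act × σ)) : σ × (ℕ → ℕ) → σ × (ℕ → ℕ) → Prop :=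
  Relation.ReflTransGen (MStep T)

/-- A relation between register contents is realizable if it is the input-output relation of a
finite counter machine. -/
def Realizable (R : (ℕ → ℕ) → (ℕ → ℕ) → Prop) : Prop :=
  ∃ (σ : Type) (_ : Finite σ) (T : Set (σ × Act × σ)) (a b : σ), T.Finite ∧
    ∀ s s', R s s' ↔ MReach T (a, s) (b, s')

theorem Realizable.act (x : Act) : Realizable x.Run := by
  refine ⟨Bool, inferInstance, {(false, x, true)}, false, true, Set.finite_singleton _, ?_⟩
  intro s s'
  constructor
  · intro h
    exact .single ⟨x, rfl, h⟩
  · intro h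
    have key : ∀ c, MReach {(false, x, true)} (false, s) c →
        (c.1 = false ∧ c.2 = s) ∨ (c.1 = true ∧ x.Run s c.2) := by
      intro c hc
      induction hc with
      | refl => exact .inl ⟨rfl, rfl⟩
      | tail _ h ih =>
        obtain ⟨y, hy, hr⟩ := h
        simp only [Set.mem_singleton_iff, Prod.mk.injEq] at hy
        obtain ⟨h1, rfl, h2⟩ := hy
        rcases ih with ⟨_, h3⟩ | ⟨h3, _⟩
        · rw [h3] at hr
          exact .inr ⟨h2, hr⟩
        · simp [h1] at h3
    rcases key _ h with ⟨h1, _⟩ | ⟨_, h2⟩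
    · simp at h1
    · exact h2

theorem MReach.lift {σ τ : Type} {T : Set (σ × Act × σ)} {U : Set (τ × Act × τ)} (f : σ → τ)
    (hf : ∀ q x q', (q, x, q') ∈ T → (f q, x, f q') ∈ U) {c c' : σ × (ℕ → ℕ)}
    (h : MReach T c c') : MReach U (f c.1, c.2) (f c'.1, c'.2) := by
  induction h with
  | refl => exact .refl
  | tail _ h ih =>
    obtain ⟨x, hx, hr⟩ := h
    exact ih.tail ⟨x, hf _ _ _ hx, hr⟩

theorem Realizable.comp {R S : (ℕ → ℕ) → (ℕ → ℕ) → Prop} (hR : Realizable R)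
    (hS : Realizable S) : Realizable fun s s' => ∃ t, R s t ∧ S t s' := by
  obtain ⟨σ, _, T, a, b, hT, hR⟩ := hR
  obtain ⟨τ, _, U, c, d, hU, hS⟩ := hS
  let V : Set ((σ ⊕ τ) × Act × (σ ⊕ τ)) :=
    ((fun e => (.inl e.1, e.2.1, .inl e.2.2)) '' T ∪
      (fun e => (.inr e.1, e.2.1, .inr e.2.2)) '' U) ∪ {(.inl b, .nop, .inr c)}
  refine ⟨σ ⊕ τ, inferInstance, V, .inl a, .inr d,
    ((hT.image _).union (hU.image _)).union (Set.finite_singleton _), ?_⟩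
  intro s s'
  constructor
  · rintro ⟨t, h1, h2⟩
    have h1' : MReach V (.inl a, s) (.inl b, t) := MReach.lift Sum.inl
      (fun q x q' h => .inl (.inl ⟨_, h, rfl⟩)) ((hR _ _).1 h1)
    have h2' : MReach V (.inr c, t) (.inr d, s') := MReach.lift Sum.inr
      (fun q x q' h => .inl (.inr ⟨_, h, rfl⟩)) ((hS _ _).1 h2)
    have h3 : MStep V (.inl b, t) (.inr c, t) := ⟨.nop, .inr rfl, rfl⟩
    exact (h1'.tail h3).trans h2'
  · intro h
    -- No instruction leads back from the second machine to the first, so a run splits at its only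
    -- crossing from `b` to `c`.
    have key : ∀ e, MReach V (.inl a, s) e →
        (∃ q, e.1 = .inl q ∧ MReach T (a, s) (q, e.2)) ∨
        (∃ q t, e.1 = .inr q ∧ R s t ∧ MReach U (c, t) (q, e.2)) := by
      intro e he
      induction he with
      | refl => exact .inl ⟨a, rfl, .refl⟩
      | @tail e e' _ h ih =>
        obtain ⟨e1, e2⟩ := e
        obtain ⟨e1', e2'⟩ := e'
        obtain ⟨x, ((⟨⟨q, y, q'⟩, hm, he⟩ | ⟨⟨q, y, q'⟩, hm, he⟩) | he), hr⟩ := h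
        · simp only [Prod.mk.injEq] at he
          obtain ⟨rfl, rfl, rfl⟩ := he
          rcases ih with ⟨q1, h1, h2⟩ | ⟨q1, t, h1, _⟩
          · cases h1
            exact .inl ⟨q', rfl, h2.tail ⟨_, hm, hr⟩⟩
          · cases h1
        · simp only [Prod.mk.injEq] at he
          obtain ⟨rfl, rfl, rfl⟩ := he
          rcases ih with ⟨q1, h1, h2⟩ | ⟨q1, t, h1, h2, h3⟩
          · cases h1
          · cases h1
            exact .inr ⟨q', t, rfl, h2, h3.tail ⟨_, hm, hr⟩⟩
        · simp only [Set.mem_singleton_iff, Prod.mk.injEq] at he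
          obtain ⟨rfl, rfl, rfl⟩ := he
          cases hr
          rcases ih with ⟨q1, h1, h2⟩ | ⟨q1, t, h1, h2, h3⟩
          · cases h1
            exact .inr ⟨c, e2, rfl, (hR _ _).2 h2, .refl⟩
          · cases h1
    rcases key _ h with ⟨q, h1, _⟩ | ⟨q, t, h1, h2, h3⟩
    · cases h1
    · cases h1
      exact ⟨t, h2, (hS _ _).2 h3⟩

theorem Realizable.star {R : (ℕ → ℕ) → (ℕ → ℕ) → Prop} (hR : Realizable R) :
    Realizable (Relation.ReflTransGen R) := by
  obtain ⟨σ, _, T, a, b, hT, hR⟩ := hR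
  -- The new state `none` is a hub, visited between complete passes of the machine.
  let V : Set (Option σ × Act × Option σ) :=
    (fun e => (some e.1, e.2.1, some e.2.2)) '' T ∪
      {(none, .nop, some a), (some b, .nop, none)}
  refine ⟨Option σ, inferInstance, V, none, none, (hT.image _).union (by simp), ?_⟩
  intro s s'
  constructor
  · intro h
    induction h with
    | refl => exact .refl
    | @tail t t' _ h ih =>
      have h1 : MReach V (some a, t) (some b, t') := MReach.lift some
        (fun q x q' h => .inl ⟨_, h, rfl⟩) ((hR _ _).1 h)
      exact ((ih.tail (c := (some a, t)) ⟨.nop, by simp [V], rfl⟩).trans h1).tail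
        ⟨.nop, by simp [V], rfl⟩
  · intro h
    have key : ∀ e, MReach V (none, s) e →
        (e.1 = none ∧ Relation.ReflTransGen R s e.2) ∨
        (∃ q t, e.1 = some q ∧ Relation.ReflTransGen R s t ∧ MReach T (a, t) (q, e.2)) := by
      intro e he
      induction he with
      | refl => exact .inl ⟨rfl, .refl⟩
      | @tail e e' _ h ih =>
        obtain ⟨e1, e2⟩ := e
        obtain ⟨e1', e2'⟩ := e'
        obtain ⟨x, (⟨⟨q, y, q'⟩, hm, he⟩ | he | he), hr⟩ := h
        · simp only [Prod.mk.injEq] at he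
          obtain ⟨rfl, rfl, rfl⟩ := he
          rcases ih with ⟨h1, _⟩ | ⟨q1, t, h1, h2, h3⟩
          · cases h1
          · cases h1
            exact .inr ⟨q', t, rfl, h2, h3.tail ⟨_, hm, hr⟩⟩
        · simp only [Prod.mk.injEq] at he
          obtain ⟨rfl, rfl, rfl⟩ := he
          cases hr
          rcases ih with ⟨_, h2⟩ | ⟨q1, t, h1, _⟩
          · exact .inr ⟨a, _, rfl, h2, .refl⟩
          · cases h1
        · simp only [Set.mem_singleton_iff, Prod.mk.injEq] at he
          obtain ⟨rfl, rfl, rfl⟩ := he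
          cases hr
          rcases ih with ⟨h1, _⟩ | ⟨q1, t, h1, h2, h3⟩
          · cases h1
          · cases h1
            exact .inl ⟨rfl, h2.tail ((hR _ _).2 h3)⟩
    rcases key _ h with ⟨_, h1⟩ | ⟨q, t, h1, _⟩
    · exact h1
    · cases h1

/-! ## Programs that compute functions -/

/-- Some finite counter machine acts on the register contents that satisfy `I` as the function
`F`. -/
def Does (I : (ℕ → ℕ) → Prop) (F : (ℕ → ℕ) → (ℕ → ℕ)) : Prop :=
  ∃ R, Realizable R ∧ ∀ s, I s → ∀ s', R s s' ↔ s' = F s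

theorem Does.comp {I J : (ℕ → ℕ) → Prop} {F G : (ℕ → ℕ) → (ℕ → ℕ)} (hF : Does I F)
    (hG : Does J G) (h : ∀ s, I s → J (F s)) : Does I fun s => G (F s) := by
  obtain ⟨R, hR, hF⟩ := hF
  obtain ⟨S, hS, hG⟩ := hG
  refine ⟨_, hR.comp hS, fun s hs s' => ?_⟩
  simp only [hF s hs, exists_eq_left]
  exact hG _ (h s hs) _

theorem Does.congr {I J : (ℕ → ℕ) → Prop} {F G : (ℕ → ℕ) → (ℕ → ℕ)} (hF : Does I F)
    (h : ∀ s, J s → I s ∧ F s = G s) : Does J G := by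
  obtain ⟨R, hR, hF⟩ := hF
  refine ⟨R, hR, fun s hs s' => ?_⟩
  rw [hF s (h s hs).1, (h s hs).2]

theorem Does.skip {I : (ℕ → ℕ) → Prop} : Does I fun s => s :=
  ⟨_, Realizable.act .nop, fun _ _ _ => Iff.rfl⟩

theorem Does.inc {I : (ℕ → ℕ) → Prop} (i : ℕ) :
    Does I fun s => Function.update s i (s i + 1) :=
  ⟨_, Realizable.act (.inc i), fun _ _ _ => Iff.rfl⟩

/-- The loop that decrements register `i` and runs `G` until register `i` is empty. -/
theorem Does.loop {I J : (ℕ → ℕ) → Prop} {G H : (ℕ → ℕ) → (ℕ → ℕ)} (i : ℕ) (hG : Does J G)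
    (h0 : ∀ s, I s → s i = 0 → H s = s)
    (h1 : ∀ s, I s → s i ≠ 0 → J (Function.update s i (s i - 1)) ∧
      I (G (Function.update s i (s i - 1))) ∧
      G (Function.update s i (s i - 1)) i = s i - 1 ∧
      H s = H (G (Function.update s i (s i - 1)))) : Does I H := by
  obtain ⟨R, hR, hG⟩ := hG
  -- The iteration may stop at any time; the final test for zero blocks all exits but the one with
  -- an empty register, which makes the loop deterministic.
  refine ⟨_, (((Realizable.act (.dec i)).comp hR).star).comp (Realizable.act (.zero i)), ?_⟩
  intro s hs s'
  induction h : s i generalizing s with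
  | zero =>
    rw [h0 s hs h]
    constructor
    · rintro ⟨t, ht, h2, rfl⟩
      rcases Relation.ReflTransGen.cases_head ht with rfl | ⟨u, ⟨v, ⟨h3, _⟩, _⟩, _⟩
      · rfl
      · exact absurd h h3
    · rintro rfl
      exact ⟨s', .refl, h, rfl⟩
  | succ n ih =>
    have hne : s i ≠ 0 := by omega
    obtain ⟨hJ, hI, hi, hH⟩ := h1 s hs hne
    have := ih _ hI (by omega)
    rw [hH, ← this]
    constructor
    · rintro ⟨t, ht, h2, rfl⟩
      rcases Relation.ReflTransGen.cases_head ht with rfl | ⟨u, ⟨v, ⟨h3, rfl⟩, h4⟩, h5⟩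
      · exact absurd h2 hne
      · rw [hG _ hJ] at h4
        subst h4
        exact ⟨_, h5, h2, rfl⟩
    · rintro ⟨t, ht, h2⟩
      exact ⟨t, .head ⟨_, ⟨hne, rfl⟩, (hG _ hJ _).2 rfl⟩ ht, h2⟩

theorem Does.clear {I : (ℕ → ℕ) → Prop} (i : ℕ) : Does I fun s => Function.update s i 0 := by
  have : Does (fun _ => True) fun s => Function.update s i 0 := by
    refine Does.loop (J := fun _ => True) i Does.skip ?_ ?_
    · intro s _ h
      rw [← h, Function.update_eq_self]
    · intro s _ h
      simp
  exact this.congr fun s _ => ⟨trivial, rfl⟩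

/-- Move the content of a register to another one. -/
theorem Does.move {I : (ℕ → ℕ) → Prop} {i o : ℕ} (h : i ≠ o) :
    Does I fun s => Function.update (Function.update s o (s o + s i)) i 0 := by
  have : Does (fun _ => True)
      fun s => Function.update (Function.update s o (s o + s i)) i 0 := by
    refine Does.loop (J := fun _ => True) i (Does.inc o) ?_ ?_
    · intro s _ h0
      funext j
      simp only [Function.update_apply]
      split_ifs <;> simp_all
    · intro s _ h0
      refine ⟨trivial, trivial, by simp [h], ?_⟩
      funext j
      simp only [Function.update_apply]
      split_ifs <;> simp_all; try omega
  exact this.congr fun s _ => ⟨trivial, rfl⟩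

/-- Move the content of a register to two other ones. -/
theorem Does.move₂ {I : (ℕ → ℕ) → Prop} {i o m : ℕ} (h : i ≠ o) (h' : i ≠ m) (h'' : o ≠ m) :
    Does I fun s => Function.update (Function.update (Function.update s o (s o + s i))
      m (s m + s i)) i 0 := by
  have : Does (fun _ => True) fun s => Function.update (Function.update
      (Function.update s o (s o + s i)) m (s m + s i)) i 0 := by
    refine Does.loop (J := fun _ => True) i
      ((Does.inc o).comp (Does.inc (I := fun _ => True) m) fun _ _ => trivial) ?_ ?_
    · intro s _ h0
      funext j
      simp only [Function.update_apply]
      split_ifs <;> simp_all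
    · intro s _ h0
      refine ⟨trivial, trivial, by simp [h, h'], ?_⟩
      funext j
      simp only [Function.update_apply]
      split_ifs <;> simp_all <;> omega
  exact this.congr fun s _ => ⟨trivial, rfl⟩

/-- Copy the content of a register to an empty one, with the help of another empty register. -/
theorem Does.copy {i o m : ℕ} (h : i ≠ o) (h' : i ≠ m) (h'' : o ≠ m) :
    Does (fun s => s o = 0 ∧ s m = 0) fun s => Function.update s o (s i) := by
  refine ((Does.move₂ h h' h'').comp (Does.move (I := fun _ => True) h'.symm)
    fun _ _ => trivial).congr fun s hs => ⟨hs, ?_⟩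
  funext j
  simp only [Function.update_apply]
  split_ifs <;> simp_all

/-- A function is computed by a counter machine if, for all input registers `inp` and each output
register `o` below `m`, some machine writes the result to `o` and otherwise leaves the registers as
they were, provided that `o` and all registers from `m` on are empty. -/
def Computes {n : ℕ} (f : List.Vector ℕ n → ℕ) : Prop :=
  ∀ (inp : Fin n → ℕ) (o m : ℕ), (∀ i, inp i < m) → o < m → (∀ i, inp i ≠ o) →
    Does (fun s => (∀ j, m ≤ j → s j = 0) ∧ s o = 0)
      fun s => Function.update s o (f (List.Vector.ofFn fun i => s (inp i)))

theorem Computes.zero : Computes (n := 0) fun _ => 0 := by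
  intro inp o m _ _ _
  refine Does.skip.congr fun s hs => ⟨hs, ?_⟩
  exact (Function.update_eq_iff.2 ⟨hs.2.symm, fun _ _ => rfl⟩).symm

theorem Computes.get {n : ℕ} (i : Fin n) : Computes fun v => v.get i := by
  intro inp o m hm ho hne
  refine (Does.copy (hne i) (hm i).ne ho.ne).congr fun s hs => ⟨⟨hs.2, hs.1 m le_rfl⟩, ?_⟩
  simp

theorem Computes.succ : Computes (n := 1) fun v => v.head.succ := by
  intro inp o m hm ho hne
  refine ((Does.copy (hne 0) (hm 0).ne ho.ne).comp (Does.inc (I := fun _ => True) o)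
    fun _ _ => trivial).congr fun s hs => ⟨⟨hs.2, hs.1 m le_rfl⟩, ?_⟩
  simp [List.Vector.ofFn]

/-- The `n` results go to the registers `m`, ..., `m + n - 1`. Each computation takes its scratch
registers from `m + n` on, so it does not disturb the earlier results. -/
theorem Computes.parallel {n k : ℕ} (g : Fin n → List.Vector ℕ k → ℕ)
    (hg : ∀ i, Computes (g i)) (inp : Fin k → ℕ) (m : ℕ) (hm : ∀ i, inp i < m) (l : ℕ)
    (hl : l ≤ n) :
    Does (fun s => ∀ j, m ≤ j → s j = 0) fun s j =>
      if h : m ≤ j ∧ j < m + l then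
        g ⟨j - m, by omega⟩ (List.Vector.ofFn fun i => s (inp i)) else s j := by
  induction l with
  | zero =>
    refine Does.skip.congr fun s hs => ⟨hs, ?_⟩
    funext j
    rw [dif_neg (by omega)]
  | succ l ih =>
    have h1 := hg ⟨l, hl⟩ inp (m + l) (m + n) (fun i => by have := hm i; omega) (by omega)
      (fun i => by have := hm i; omega)
    refine ((ih (by omega)).comp h1 ?_).congr fun s hs => ⟨hs, ?_⟩
    · intro s hs
      refine ⟨fun j hj => ?_, ?_⟩
      · exact (dif_neg (by omega)).trans (hs j (by omega))
      · exact (dif_neg (by omega)).trans (hs _ (by omega))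
    · have hv : ∀ i : Fin k, ¬ (m ≤ inp i ∧ inp i < m + l) := fun i => by
        have := hm i; omega
      funext j
      simp only [Function.update_apply, hv, dite_false]
      by_cases hj : j = m + l
      · subst hj
        simp
      · rw [if_neg hj]
        by_cases h2 : m ≤ j ∧ j < m + l
        · rw [dif_pos h2, dif_pos (by omega)]
        · rw [dif_neg h2, dif_neg (by omega)]

theorem Does.clearRange (m l : ℕ) :
    Does (fun _ => True) fun s j => if m ≤ j ∧ j < m + l then 0 else s j := by
  induction l with
  | zero =>
    refine Does.skip.congr fun s hs => ⟨hs, ?_⟩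
    funext j
    rw [if_neg (by omega)]
  | succ l ih =>
    refine (ih.comp (Does.clear (I := fun _ => True) (m + l)) fun _ _ => trivial).congr
      fun s hs => ⟨hs, ?_⟩
    funext j
    simp only [Function.update_apply]
    split_ifs <;> first | rfl | omega

theorem Computes.comp {n k : ℕ} {f : List.Vector ℕ n → ℕ} (g : Fin n → List.Vector ℕ k → ℕ)
    (hf : Computes f) (hg : ∀ i, Computes (g i)) :
    Computes fun v => f (List.Vector.ofFn fun i => g i v) := by
  intro inp o m hm ho hne
  have h1 := Computes.parallel g hg inp m hm n le_rfl
  have h2 := hf (fun i => m + i) o (m + n) (fun i => by omega) (by omega) (fun i => by omega)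
  refine (((h1.congr (J := fun s => (∀ j, m ≤ j → s j = 0) ∧ s o = 0)
    fun s hs => ⟨hs.1, rfl⟩).comp h2 ?_).comp (Does.clearRange m n) fun _ _ => trivial).congr
    fun s hs => ⟨hs, ?_⟩
  · intro s hs
    refine ⟨fun j hj => ?_, ?_⟩
    · exact (dif_neg (by omega)).trans (hs.1 j (by omega))
    · exact (dif_neg (by omega)).trans hs.2
  · funext j
    have h3 : ∀ i : Fin n, m ≤ m + (i : ℕ) ∧ m + (i : ℕ) < m + n := fun i => by omega
    simp only [Function.update_apply, h3, and_self, dite_true, Nat.add_sub_cancel_left]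
    by_cases hj : m ≤ j ∧ j < m + n
    · rw [if_pos hj, if_neg (by omega), hs.1 j hj.1]
    · rw [if_neg hj, dif_neg hj]

/-- Register `m` holds the current value of the recursion, `m + 1` the number of rounds done, `m +
2` the rounds still to do, and `m + 3` receives the next value. The loop invariant is that `m`
contains the value at the argument in `m + 1`. -/
theorem Computes.prec {n : ℕ} {f : List.Vector ℕ n → ℕ} {g : List.Vector ℕ (n + 2) → ℕ}
    (hf : Computes f) (hg : Computes g) : Computes fun v : List.Vector ℕ (n + 1) =>
      v.head.rec (f v.tail) fun y IH => g (y ::ᵥ IH ::ᵥ v.tail) := by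
  intro inp o m hm ho hne
  let φ : List.Vector ℕ n → ℕ → ℕ := fun w y => y.rec (f w) fun y IH => g (y ::ᵥ IH ::ᵥ w)
  let v : (ℕ → ℕ) → List.Vector ℕ n := fun s => List.Vector.ofFn fun i => s (inp i.succ)
  have hv : ∀ s s' : ℕ → ℕ, (∀ j, j < m → s j = s' j) → v s = v s' := by
    intro s s' h
    simp only [v]
    congr 1
    funext i
    exact h _ (hm _)
  have hbody : Does (fun s => ∀ j, m + 3 ≤ j → s j = 0) fun s =>
      Function.update (Function.update s m (g (s (m + 1) ::ᵥ s m ::ᵥ v s))) (m + 1)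
        (s (m + 1) + 1) := by
    have h1 := hg (Fin.cons (m + 1) (Fin.cons m fun i => inp i.succ)) (m + 3) (m + 4) ?_
      (by omega) ?_
    · refine (((h1.comp (Does.clear (I := fun _ => True) m) fun _ _ => trivial).comp
        (Does.move (I := fun _ => True) (i := m + 3) (o := m) (by omega))
        fun _ _ => trivial).comp (Does.inc (I := fun _ => True) (m + 1)) fun _ _ => trivial).congr
        fun s hs => ⟨⟨fun j hj => hs j (by omega), hs _ le_rfl⟩, ?_⟩
      have h2 : (List.Vector.ofFn fun i => s ((Fin.cons (m + 1) (Fin.cons m fun i => inp i.succ) :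
          Fin (n + 2) → ℕ) i)) = s (m + 1) ::ᵥ s m ::ᵥ v s := rfl
      rw [h2]
      have h3 := hs (m + 3) le_rfl
      funext j
      simp only [Function.update_apply]
      split_ifs <;> simp_all
    · refine Fin.cases (by simp) (Fin.cases (by simp) fun i => ?_)
      have := hm i.succ
      simp only [Fin.cons_succ]
      omega
    · refine Fin.cases (by simp) (Fin.cases (by simp) fun i => ?_)
      have := hm i.succ
      simp only [Fin.cons_succ]
      omega
  have hloop : Does (fun s => (∀ j, m + 3 ≤ j → s j = 0) ∧ s m = φ (v s) (s (m + 1))) fun s =>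
      Function.update (Function.update (Function.update s m (φ (v s) (s (m + 1) + s (m + 2))))
        (m + 1) (s (m + 1) + s (m + 2))) (m + 2) 0 := by
    refine Does.loop (m + 2) hbody ?_ ?_
    · intro s hs h0
      have h1 := hs.2
      funext j
      simp only [Function.update_apply]
      split_ifs <;> simp_all
    · intro s hs h0
      have e1 : v (Function.update s (m + 2) (s (m + 2) - 1)) = v s := by
        refine hv _ _ fun j hj => ?_
        rw [Function.update_of_ne (by omega)]
      have e2 : v (Function.update (Function.update (Function.update s (m + 2) (s (m + 2) - 1)) m
          (g (s (m + 1) ::ᵥ s m ::ᵥ v s))) (m + 1) (s (m + 1) + 1)) = v s := by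
        refine hv _ _ fun j hj => ?_
        rw [Function.update_of_ne (by omega), Function.update_of_ne (by omega),
          Function.update_of_ne (by omega)]
      have e3 : Function.update s (m + 2) (s (m + 2) - 1) (m + 1) = s (m + 1) :=
        Function.update_of_ne (by omega) _ _
      have e4 : Function.update s (m + 2) (s (m + 2) - 1) m = s m :=
        Function.update_of_ne (by omega) _ _
      rw [e1, e3, e4, e2]
      refine ⟨fun j hj => ?_, ⟨fun j hj => ?_, ?_⟩, ?_, ?_⟩
      · rw [Function.update_of_ne (by omega), hs.1 j hj]
      · rw [Function.update_of_ne (by omega), Function.update_of_ne (by omega),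
          Function.update_of_ne (by omega), hs.1 j hj]
      · rw [Function.update_of_ne (by omega), Function.update_self, Function.update_self, hs.2]
      · rw [Function.update_of_ne (by omega), Function.update_of_ne (by omega),
          Function.update_self]
      · have e5 : s (m + 1) + 1 + (s (m + 2) - 1) = s (m + 1) + s (m + 2) := by omega
        have a1 : m + 2 ≠ m + 1 := by omega
        have a2 : m + 2 ≠ m := by omega
        have a3 : m + 1 ≠ m := by omega
        generalize g (s (m + 1) ::ᵥ s m ::ᵥ v s) = z
        simp only [Function.update_self, Function.update_of_ne a1, Function.update_of_ne a2, e5]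
        generalize φ (v s) (s (m + 1) + s (m + 2)) = y
        funext j
        by_cases b1 : j = m + 2
        · simp only [b1, Function.update_self]
        by_cases b2 : j = m + 1
        · simp only [b2, Function.update_self, Function.update_of_ne a1.symm]
        by_cases b3 : j = m
        · simp only [b3, Function.update_self, Function.update_of_ne a2.symm,
            Function.update_of_ne a3.symm]
        · simp only [Function.update_of_ne b1, Function.update_of_ne b2, Function.update_of_ne b3]
  -- The recursion argument is copied, since the loop counts it down and the input has to survive.
  have hcopy := Does.copy (i := inp 0) (o := m + 2) (m := m + 3)
    (by have := hm 0; omega) (by have := hm 0; omega) (by omega)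
  have hf' := hf (fun i => inp i.succ) m (m + 4) (fun i => by have := hm i.succ; omega) (by omega)
    (fun i => (hm i.succ).ne)
  refine (((((hcopy.congr (J := fun s => (∀ j, m ≤ j → s j = 0) ∧ s o = 0)
    fun s hs => ⟨⟨hs.1 _ (by omega), hs.1 _ (by omega)⟩, rfl⟩).comp hf' ?_).comp hloop ?_).comp
    (Does.move (I := fun _ => True) (i := m) (o := o) (by omega)) fun _ _ => trivial).comp
    (Does.clear (I := fun _ => True) (m + 1)) fun _ _ => trivial).congr fun s hs => ⟨hs, ?_⟩
  · intro s hs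
    refine ⟨fun j hj => ?_, ?_⟩
    · rw [Function.update_of_ne (by omega), hs.1 j (by omega)]
    · rw [Function.update_of_ne (by omega), hs.1 m le_rfl]
  · intro s hs
    have e1 : v (Function.update s (m + 2) (s (inp 0))) = v s := by
      refine hv _ _ fun j hj => ?_
      rw [Function.update_of_ne (by omega)]
    change (∀ j, m + 3 ≤ j → Function.update (β := fun _ => ℕ) _ m (f (v _)) j = 0) ∧
      Function.update (β := fun _ => ℕ) _ m (f (v _)) m =
        φ (v (Function.update _ m (f (v _)))) _
    have e2 : v (Function.update (Function.update s (m + 2) (s (inp 0))) m (f (v s))) = v s := by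
      refine hv _ _ fun j hj => ?_
      rw [Function.update_of_ne (by omega), Function.update_of_ne (by omega)]
    rw [e1, e2]
    refine ⟨fun j hj => ?_, ?_⟩
    · rw [Function.update_of_ne (by omega), Function.update_of_ne (by omega), hs.1 j (by omega)]
    · rw [Function.update_self, Function.update_of_ne (by omega),
        Function.update_of_ne (by omega), hs.1 (m + 1) (by omega)]
      rfl
  · have e1 : v (Function.update s (m + 2) (s (inp 0))) = v s := by
      refine hv _ _ fun j hj => ?_
      rw [Function.update_of_ne (by omega)]
    have e2 : v (Function.update (Function.update s (m + 2) (s (inp 0))) m (f (v s))) = v s := by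
      refine hv _ _ fun j hj => ?_
      rw [Function.update_of_ne (by omega), Function.update_of_ne (by omega)]
    change _ = Function.update s o (φ (v s) (s (inp 0)))
    have e3 : (List.Vector.ofFn fun i => Function.update s (m + 2) (s (inp 0)) (inp (Fin.succ i)))
      = v s := e1
    rw [e3, e2]
    have h1 := hs.1 (m + 1) (by omega)
    have h2 := hs.1 (m + 2) (by omega)
    have h3 := hs.1 m (by omega)
    have h4 := hs.2
    funext j
    simp only [Function.update_apply]
    have a1 : m + 1 ≠ m := by omega
    have a2 : o ≠ m := by omega
    have a3 : o ≠ m + 1 := by omega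
    have a4 : o ≠ m + 2 := by omega
    by_cases b1 : j = m + 1
    · simp [b1, a3.symm, h1]
    by_cases b2 : j = m
    · simp [b2, a2.symm, h3]
    by_cases b3 : j = m + 2
    · simp [b3, a4.symm, h2]
    by_cases b4 : j = o
    · simp [b4, a2, a3, a4, h1, h4]
    · simp [b1, b2, b3, b4]

theorem Computes.of_primrec {n : ℕ} {f : List.Vector ℕ n → ℕ} (hf : Nat.Primrec' f) :
    Computes f := by
  induction hf with
  | zero => exact .zero
  | succ => exact .succ
  | get i => exact .get i
  | comp g _ _ hf hg => exact .comp g hf hg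
  | prec _ _ hf hg => exact .prec hf hg

/-! ## A universal machine -/

open Nat.Partrec (Code)

/-- One if the code halts on input zero with the given fuel, and zero otherwise. -/
def haltsWithin (fuel n : ℕ) : ℕ :=
  bif (Code.evaln fuel (Denumerable.ofNat Code n) 0).isSome then 1 else 0

theorem primrec_haltsWithin : Primrec₂ haltsWithin := by
  have h1 : Primrec fun p : ℕ × ℕ => Code.evaln p.1 (Denumerable.ofNat Code p.2) 0 :=
    Code.primrec_evaln.comp
      ((Primrec.fst.pair ((Primrec.ofNat Code).comp Primrec.snd)).pair (.const 0))
  have h2 : Primrec fun p : ℕ × ℕ => (Code.evaln p.1 (Denumerable.ofNat Code p.2) 0).isSome :=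
    Primrec.option_isSome.comp h1
  exact Primrec.cond h2 (.const 1) (.const 0)

theorem exists_haltsWithin (c : Code) :
    (c.eval 0).Dom ↔ ∃ k, haltsWithin k (Encodable.encode c) ≠ 0 := by
  rw [Part.dom_iff_mem]
  simp only [Code.evaln_complete, haltsWithin, Denumerable.ofNat_encode, Option.mem_def]
  rw [exists_comm]
  simp [Bool.cond_eq_ite, Option.isSome_iff_exists]

/-- Nondeterminism replaces the unbounded search for fuel, so primitive recursive computation is
enough. -/
theorem realizable_halting : ∃ R, Realizable R ∧ ∀ c : Code,
    (c.eval 0).Dom ↔ ∃ s', R (Function.update (fun _ => 0) 0 (Encodable.encode c)) s' := by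
  obtain ⟨G, hG, hGs⟩ := Computes.of_primrec (Nat.Primrec'.prim_iff₂.2 primrec_haltsWithin)
    ![1, 0] 2 3 (by decide) (by decide) (by decide)
  -- Iterated increments guess the fuel in register one, the result goes to register two, and a
  -- decrement succeeds only if it is nonzero.
  refine ⟨_, (((Realizable.act (.inc 1)).star).comp hG).comp (.act (.dec 2)), fun c => ?_⟩
  have hstar : ∀ s t, Relation.ReflTransGen (Act.inc 1).Run s t ↔
      ∃ k, t = Function.update s 1 (s 1 + k) := by
    intro s t
    constructor
    · intro h
      induction h with
      | refl => exact ⟨0, by simp⟩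
      | tail _ h ih =>
        obtain ⟨k, rfl⟩ := ih
        cases h
        exact ⟨k + 1, by simp [add_assoc]⟩
    · rintro ⟨k, rfl⟩
      induction k with
      | zero => simpa using Relation.ReflTransGen.refl
      | succ k ih => exact ih.tail (by simp [Act.Run, add_assoc])
  rw [exists_haltsWithin]
  have hrun : ∀ (n k : ℕ) (t : ℕ → ℕ),
      G (Function.update (Function.update (fun _ => 0) 0 n) 1 k) t ↔
        t = Function.update (Function.update (Function.update (fun _ => 0) 0 n) 1 k) 2
          (haltsWithin k n) := by
    intro n k t
    refine (hGs _ ⟨fun j hj => ?_, by simp⟩ t).trans ?_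
    · rw [Function.update_of_ne (by omega), Function.update_of_ne (by omega)]
    · simp [List.Vector.ofFn]
  constructor
  · rintro ⟨k, hk⟩
    exact ⟨_, _, ⟨_, (hstar _ _).2 ⟨k, rfl⟩, (hrun _ _ _).2 (by simp; rfl)⟩, by simpa using hk, rfl⟩
  · rintro ⟨s', t, ⟨u, hu, ht⟩, hne, _⟩
    obtain ⟨k, rfl⟩ := (hstar _ _).1 hu
    rw [hrun] at ht
    subst ht
    exact ⟨_, by simpa using hne⟩

/-- A counter machine with finitely many states and instructions, a start state and a final state,
and a number `size` that is meant to bound its registers. -/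
structure Machine where
  State : Type
  finite : Finite State
  prog : Set (State × Act × State)
  prog_finite : prog.Finite
  start : State
  final : State
  size : ℕ

/-- All registers of the instruction are below `k`. -/
def Act.Bounded (k : ℕ) : Act → Prop
  | nop => True
  | inc i => i < k
  | dec i => i < k
  | zero i => i < k

theorem Act.Bounded.mono {k l : ℕ} (h : k ≤ l) {x : Act} (hx : x.Bounded k) : x.Bounded l := by
  cases x <;> simp only [Act.Bounded] at hx ⊢ <;> omega

theorem Act.exists_bounded (x : Act) : ∃ k, x.Bounded k := by
  cases x with
  | nop => exact ⟨0, trivial⟩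
  | inc i => exact ⟨i + 1, i.lt_succ_self⟩
  | dec i => exact ⟨i + 1, i.lt_succ_self⟩
  | zero i => exact ⟨i + 1, i.lt_succ_self⟩

theorem exists_halting_machine : ∃ m : Machine, 0 < m.size ∧
    (∀ e ∈ m.prog, e.2.1.Bounded m.size) ∧ ∀ c : Code,
      (c.eval 0).Dom ↔
        ∃ s, MReach m.prog (m.start, Function.update (fun _ => 0) 0 (Encodable.encode c))
          (m.final, s) := by
  obtain ⟨R, ⟨σ, hσ, T, a, b, hT, hR⟩, h⟩ := realizable_halting
  choose bd hbd using Act.exists_bounded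
  obtain ⟨k, hk⟩ := (hT.image fun e => bd e.2.1).bddAbove
  -- With `k + 1` the size is positive even if `k = 0`, so register zero, which takes the input,
  -- does not share its place with the clock.
  refine ⟨⟨σ, hσ, T, hT, a, b, k + 1⟩, k.succ_pos, fun e he => ?_, fun c => ?_⟩
  · exact (hbd e.2.1).mono ((hk ⟨e, he, rfl⟩).trans k.le_succ)
  · rw [h]
    exact exists_congr fun s => hR _ _

/-! ## Nets in which the cost is the total age -/

/-- The closed interval that contains only `k`. -/
def Interval.point (k : ℕ) : Interval := ⟨k, true, some (k, true)⟩

theorem Interval.mem_point {k : ℕ} {x : ℝ≥0} : (Interval.point k).Mem x ↔ x = k := by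
  simp only [Interval.Mem, Interval.point, if_true]
  exact ⟨fun h => le_antisymm h.2 h.1, fun h => ⟨h.ge, h.le⟩⟩

/-- A transition that consumes tokens of given integer ages and produces tokens of age zero. -/
def pointTransition {Q P : Type} (q q' : Q) (A : Multiset (P × ℕ)) (O : Multiset P) :
    Transition Q P where
  source := q
  target := q'
  input := A.map fun x => (x.1, .point x.2)
  read := 0
  output := O.map fun p => (p, .point 0)

/-- Tokens of given integer ages. -/
def aged {P : Type} (A : Multiset (P × ℕ)) : Marking P := A.map fun x => (x.1, (x.2 : ℝ≥0))

/-- Tokens of age zero. -/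
def fresh {P : Type} (O : Multiset P) : Marking P := O.map fun p => (p, 0)

theorem matches_point {P : Type} {M : Marking P} {A : Multiset (P × ℕ)} :
    Matches M (A.map fun x => (x.1, Interval.point x.2)) ↔ M = aged A := by
  rw [Matches, Multiset.rel_map_right, ← Multiset.rel_eq, aged, Multiset.rel_map_right]
  simp only [Interval.mem_point, Prod.ext_iff]

theorem matches_fresh {P : Type} {M : Marking P} {O : Multiset P} :
    Matches M (O.map fun p => (p, Interval.point 0)) ↔ M = fresh O := by
  rw [Matches, Multiset.rel_map_right, ← Multiset.rel_eq, fresh, Multiset.rel_map_right]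
  simp only [Interval.mem_point, Prod.ext_iff, Nat.cast_zero]

theorem matches_zero {P : Type} {M : Marking P} : Matches M 0 ↔ M = 0 := Multiset.rel_zero_right

/-- Minus the total left ends of the input intervals. -/
def inputCost {Q P : Type} (t : Transition Q P) : ℤ :=
  -(t.input.map fun x => (x.2.lower : ℤ)).sum

/-- The sum of the ages of all tokens. -/
noncomputable def totalAge {P : Type} (M : Marking P) : ℝ := (M.map fun x => (x.2 : ℝ)).sum

theorem totalAge_nonneg {P : Type} (M : Marking P) : 0 ≤ totalAge M := by
  refine Multiset.sum_nonneg fun x hx => ?_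
  obtain ⟨y, _, rfl⟩ := Multiset.mem_map.1 hx
  exact y.2.2

theorem totalAge_add {P : Type} (M M' : Marking P) :
    totalAge (M + M') = totalAge M + totalAge M' := by
  simp [totalAge]

theorem totalAge_fresh {P : Type} (O : Multiset P) : totalAge (fresh O) = 0 := by
  simp [totalAge, fresh, Function.comp_def]

theorem totalAge_aged {P : Type} (A : Multiset (P × ℕ)) :
    totalAge (aged A) = (A.map fun x => (x.2 : ℝ)).sum := by
  simp [totalAge, aged]

theorem totalAge_delay {P : Type} (M : Marking P) (x : ℝ≥0) :
    totalAge (M.delay x) = totalAge M + x * M.card := by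
  induction M using Multiset.induction with
  | empty => simp [totalAge, Marking.delay]
  | cons y M ih =>
    simp only [totalAge, Marking.delay, Multiset.map_cons, Multiset.sum_cons,
      Multiset.card_cons] at ih ⊢
    rw [ih]
    push_cast
    ring

/-- All place costs are one, and each transition consumes tokens of integer ages, produces tokens
of age zero, and refunds the consumed ages. -/
structure Net.IsRefund {Q P : Type} (N : Net Q P) : Prop where
  placeCost : ∀ p, N.placeCost p = 1
  transCost : ∀ t, N.transCost t = inputCost t.1
  point : ∀ t ∈ N.trans, ∃ q q' A O, t = pointTransition q q' A O

theorem Net.IsRefund.storageCost {Q P : Type} {N : Net Q P} (hN : N.IsRefund) (M : Marking P) :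
    N.storageCost M = M.card := by
  simp [Net.storageCost, hN.placeCost]

/-- The cases of a step in such a net. -/
theorem Net.IsRefund.step_cases {Q P : Type} {N : Net Q P} (hN : N.IsRefund) {D : Set ℝ≥0}
    {c c' : Config Q P} {r : ℝ} (h : N.Step D c c' r) :
    (∃ x : ℝ≥0, c' = (c.1, c.2.delay x) ∧ r = x * c.2.card) ∨
    ∃ A O rest, pointTransition c.1 c'.1 A O ∈ N.trans ∧ c.2 = aged A + rest ∧
      c'.2 = fresh O + rest ∧ r = -(A.map fun x => (x.2 : ℝ)).sum := by
  cases h with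
  | time q M x pos mem => exact .inl ⟨x, rfl, by simp [hN.storageCost]⟩
  | fire t I R O rest input read output mem =>
    obtain ⟨t, ht⟩ := t
    obtain ⟨q, q', A, O', rfl⟩ := hN.point t ht
    have h1 := matches_point.1 input
    have h2 := matches_zero.1 read
    have h3 := matches_fresh.1 output
    subst h1 h2 h3
    refine .inr ⟨A, O', rest, ht, by simp, by simp, ?_⟩
    rw [hN.transCost]
    simp [inputCost, pointTransition, Interval.point, Multiset.map_map]

/-- A delay by `x` adds `x` to each age and costs `x` per token; a discrete transition removes
exactly the ages it refunds and adds none. -/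
theorem Net.IsRefund.totalAge_step {Q P : Type} {N : Net Q P} (hN : N.IsRefund) {D : Set ℝ≥0}
    {c c' : Config Q P} {r : ℝ} (h : N.Step D c c' r) :
    totalAge c'.2 = totalAge c.2 + r := by
  rcases hN.step_cases h with ⟨x, rfl, rfl⟩ | ⟨A, O, rest, _, h1, h2, rfl⟩
  · exact totalAge_delay _ _
  · rw [h1, h2, totalAge_add, totalAge_add, totalAge_fresh, totalAge_aged]
    ring

theorem Net.IsRefund.totalAge_computation {Q P : Type} {N : Net Q P} (hN : N.IsRefund)
    {D : Set ℝ≥0} {c c' : Config Q P} {r : ℝ} (h : N.Computation D c c' r) :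
    totalAge c'.2 = totalAge c.2 + r := by
  induction h with
  | nil => simp
  | cons step _ ih => rw [ih, hN.totalAge_step step, add_assoc]

/-- Reachability in a net, at any cost. -/
abbrev Net.Reach {Q P : Type} (N : Net Q P) (D : Set ℝ≥0) : Config Q P → Config Q P → Prop :=
  Relation.ReflTransGen fun c c' => ∃ r, N.Step D c c' r

theorem Net.exists_computation {Q P : Type} {N : Net Q P} {D : Set ℝ≥0} {c c' : Config Q P}
    (h : N.Reach D c c') : ∃ r, N.Computation D c c' r := by
  induction h using Relation.ReflTransGen.head_induction_on with
  | refl => exact ⟨0, .nil _⟩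
  | head h _ ih =>
    obtain ⟨r, h⟩ := h
    obtain ⟨s, ih⟩ := ih
    exact ⟨_, .cons h ih⟩

theorem Net.reach_fire {Q P : Type} {N : Net Q P} {D : Set ℝ≥0} (h0 : 0 ∈ D) {q q' : Q}
    {A : Multiset (P × ℕ)} {O : Multiset P} (ht : pointTransition q q' A O ∈ N.trans)
    (rest : Marking P) : N.Reach D (q, aged A + rest) (q', fresh O + rest) := by
  have h := Net.Step.fire (N := N) (D := D) ⟨_, ht⟩ (aged A) 0 (fresh O) rest
    (matches_point.2 rfl) (matches_zero.2 rfl) (matches_fresh.2 rfl) (by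
      intro x hx
      obtain ⟨p, _, rfl⟩ := Multiset.mem_map.1 hx
      exact h0)
  rw [add_zero, add_zero] at h
  exact .single ⟨_, h⟩

namespace Machine

/-! ## The net of a counter machine -/

variable (m : Machine)

/-- The place of a clock token. -/
def clock : Fin (m.size + 1) := Fin.last m.size

/-- The place of a register. -/
def place (i : ℕ) : Fin (m.size + 1) := Fin.ofNat (m.size + 1) i

theorem val_place {i : ℕ} (h : i < m.size) : (m.place i).val = i :=
  Nat.mod_eq_of_lt (by omega)

theorem place_ne_clock {i : ℕ} (h : i < m.size) : m.place i ≠ m.clock := by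
  intro h'
  have := congrArg Fin.val h'
  rw [m.val_place h] at this
  simp [clock] at this
  omega

theorem eq_place {x : Fin (m.size + 1)} {i : ℕ} (h : x.val = i) : x = m.place i := by
  subst h
  exact Fin.ext (Nat.mod_eq_of_lt x.2).symm

/-- The control states of the net: an initial state, the states of the machine, and for each of
them and each place a state in which all tokens outside of that place are renewed. -/
abbrev Control : Type := Option (m.State × Option (Fin (m.size + 1)))

instance : Finite m.State := m.finite

/-- The number of control states. -/
noncomputable def numControl : ℕ := Nat.card m.Control

noncomputable def controlEquiv : m.Control ≃ Fin m.numControl := Finite.equivFin _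

noncomputable def initial : Fin m.numControl := m.controlEquiv none

noncomputable def main (q : m.State) : Fin m.numControl := m.controlEquiv (some (q, none))

noncomputable def renew (q : m.State) (p : Fin (m.size + 1)) : Fin m.numControl :=
  m.controlEquiv (some (q, some p))

@[simp] theorem main_inj {q q' : m.State} : m.main q = m.main q' ↔ q = q' := by
  simp [main]

@[simp] theorem renew_inj {q q' : m.State} {p p' : Fin (m.size + 1)} :
    m.renew q p = m.renew q' p' ↔ q = q' ∧ p = p' := by
  simp [renew]

@[simp] theorem initial_ne_main {q : m.State} : m.initial ≠ m.main q := by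
  simp [initial, main]

@[simp] theorem initial_ne_renew {q : m.State} {p : Fin (m.size + 1)} :
    m.initial ≠ m.renew q p := by
  simp [initial, renew]

@[simp] theorem main_ne_renew {q q' : m.State} {p : Fin (m.size + 1)} :
    m.main q ≠ m.renew q' p := by
  simp [main, renew]

/-- The transition for an instruction.  A test for zero needs a delay of one time unit, all other
transitions happen without delay. -/
noncomputable def instr : m.State × Act × m.State →
    Transition (Fin m.numControl) (Fin (m.size + 1))
  | (q, .nop, q') => pointTransition (m.main q) (m.main q') {(m.clock, 0)} {m.clock}
  | (q, .inc i, q') =>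
    pointTransition (m.main q) (m.main q') {(m.clock, 0)} {m.clock, m.place i}
  | (q, .dec i, q') =>
    pointTransition (m.main q) (m.main q') {(m.clock, 0), (m.place i, 0)} {m.clock}
  | (q, .zero i, q') =>
    pointTransition (m.main q) (m.renew q' (m.place i)) {(m.clock, 1)} {m.clock}

/-- The transition that renews a token of age one at the place `j`. -/
noncomputable def renewToken (q : m.State) (p j : Fin (m.size + 1)) :
    Transition (Fin m.numControl) (Fin (m.size + 1)) :=
  pointTransition (m.renew q p) (m.renew q p) {(m.clock, 0), (j, 1)} {m.clock, j}

noncomputable def leave (q : m.State) (p : Fin (m.size + 1)) :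
    Transition (Fin m.numControl) (Fin (m.size + 1)) :=
  pointTransition (m.renew q p) (m.main q) {(m.clock, 0)} {m.clock}

/-- The transition that sets register zero to `n`. -/
noncomputable def load (n : ℕ) : Transition (Fin m.numControl) (Fin (m.size + 1)) :=
  pointTransition m.initial (m.main m.start) 0 (m.clock ::ₘ Multiset.replicate n (m.place 0))

/-- The transitions that do not depend on the input. -/
def fixedTrans : Set (Transition (Fin m.numControl) (Fin (m.size + 1))) :=
  (m.instr '' m.prog ∪
    -- Excluding the tested place `p.1` is what punishes a false test for zero.
    Set.range fun x : m.State × {p : Fin (m.size + 1) × Fin (m.size + 1) //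
      p.2 ≠ p.1 ∧ p.2 ≠ m.clock} => m.renewToken x.1 x.2.1.1 x.2.1.2) ∪
    Set.range fun x : m.State × Fin (m.size + 1) => m.leave x.1 x.2

theorem fixedTrans_finite : m.fixedTrans.Finite :=
  ((m.prog_finite.image _).union (Set.finite_range _)).union (Set.finite_range _)

/-- Only `load` starts in the initial state. Being new, it can be put in front of the fixed
transitions, which yields a list without repetition that depends on `n` in one entry only. -/
theorem load_notMem (n : ℕ) : m.load n ∉ m.fixedTrans_finite.toFinset := by
  rw [Set.Finite.mem_toFinset]
  have h : (m.load n).source = m.initial := rfl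
  rintro ((⟨⟨q, x, q'⟩, _, h'⟩ | ⟨x, h'⟩) | ⟨x, h'⟩)
  · rw [← h'] at h
    cases x <;> exact m.initial_ne_main h.symm
  · rw [← h'] at h
    exact m.initial_ne_renew h.symm
  · rw [← h'] at h
    exact m.initial_ne_renew h.symm

/-- The net that simulates the machine on the input `n`. -/
noncomputable def net (n : ℕ) : Net (Fin m.numControl) (Fin (m.size + 1)) where
  trans := Finset.cons (m.load n) m.fixedTrans_finite.toFinset (m.load_notMem n)
  placeCost _ := 1
  transCost t := inputCost t.1

theorem mem_trans {n : ℕ} {t : Transition (Fin m.numControl) (Fin (m.size + 1))} :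
    t ∈ (m.net n).trans ↔ t = m.load n ∨ (∃ e ∈ m.prog, t = m.instr e) ∨
      (∃ q p j, j ≠ p ∧ j ≠ m.clock ∧ t = m.renewToken q p j) ∨ ∃ q p, t = m.leave q p := by
  refine (Finset.mem_cons (h := m.load_notMem n)).trans (or_congr Iff.rfl ?_)
  rw [Set.Finite.mem_toFinset, fixedTrans, Set.mem_union, Set.mem_union, or_assoc]
  refine or_congr ?_ (or_congr ?_ ?_)
  · exact ⟨fun ⟨e, he, h⟩ => ⟨e, he, h.symm⟩, fun ⟨e, he, h⟩ => ⟨e, he, h.symm⟩⟩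
  · constructor
    · rintro ⟨⟨q, ⟨p, j⟩, h1, h2⟩, rfl⟩
      exact ⟨q, p, j, h1, h2, rfl⟩
    · rintro ⟨q, p, j, h1, h2, rfl⟩
      exact ⟨⟨q, ⟨p, j⟩, h1, h2⟩, rfl⟩
  · constructor
    · rintro ⟨⟨q, p⟩, rfl⟩
      exact ⟨q, p, rfl⟩
    · rintro ⟨q, p, rfl⟩
      exact ⟨⟨q, p⟩, rfl⟩

theorem isRefund_net (n : ℕ) : (m.net n).IsRefund where
  placeCost _ := rfl
  transCost _ := rfl
  point t ht := by
    rcases m.mem_trans.1 ht with rfl | ⟨⟨q, x, q'⟩, _, rfl⟩ | ⟨q, p, j, _, _, rfl⟩ | ⟨q, p, rfl⟩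
    · exact ⟨_, _, _, _, rfl⟩
    · cases x <;> exact ⟨_, _, _, _, rfl⟩
    · exact ⟨_, _, _, _, rfl⟩
    · exact ⟨_, _, _, _, rfl⟩

/-! ### Markings relative to the clock. -/

/-- The marking with a clock token of age `a` and further tokens that are older by integers. -/
noncomputable def tokens (a : ℝ≥0) (B : Multiset (Fin (m.size + 1) × ℕ)) :
    Marking (Fin (m.size + 1)) :=
  (m.clock, a) ::ₘ B.map fun x => (x.1, a + x.2)

/-- The register contents that are represented by a multiset of tokens. -/
def content (B : Multiset (Fin (m.size + 1) × ℕ)) (i : ℕ) : ℕ :=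
  B.countP fun x => x.1.val = i

theorem content_cons (x : Fin (m.size + 1) × ℕ) (B : Multiset (Fin (m.size + 1) × ℕ)) :
    m.content (x ::ₘ B) =
      Function.update (m.content B) x.1.val (m.content B x.1.val + 1) := by
  funext i
  simp only [content, Multiset.countP_cons, Function.update_apply]
  by_cases h : i = x.1.val
  · simp [h]
  · simp [h, Ne.symm h]

theorem content_map (f : ℕ → ℕ) (B : Multiset (Fin (m.size + 1) × ℕ)) :
    m.content (B.map fun x => (x.1, f x.2)) = m.content B := by
  funext i
  exact (Multiset.countP_map _ _ _).trans (Multiset.countP_eq_card_filter _ _).symm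

theorem content_replicate (hm : 0 < m.size) (n : ℕ) :
    m.content (Multiset.replicate n (m.place 0, 0)) = Function.update (fun _ => 0) 0 n := by
  induction n with
  | zero => funext i; simp [content]
  | succ n ih =>
    rw [Multiset.replicate_succ, content_cons, ih]
    simp [m.val_place hm]

theorem delay_tokens (a x : ℝ≥0) (B : Multiset (Fin (m.size + 1) × ℕ)) :
    (m.tokens a B).delay x = m.tokens (a + x) B := by
  simp only [tokens, Marking.delay, Multiset.map_cons, Multiset.map_map, Function.comp_def]
  congr 1
  refine Multiset.map_congr rfl fun y _ => ?_
  rw [add_right_comm]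

theorem fresh_singleton {P : Type} (p : P) : fresh {p} = {(p, 0)} := Multiset.map_singleton _ _

theorem aged_cons {P : Type} (x : P × ℕ) (A : Multiset (P × ℕ)) :
    aged (x ::ₘ A) = (x.1, (x.2 : ℝ≥0)) ::ₘ aged A := Multiset.map_cons _ _ _

theorem aged_singleton {P : Type} (x : P × ℕ) : aged {x} = {(x.1, (x.2 : ℝ≥0))} :=
  Multiset.map_singleton _ _

theorem tokens_zero (B : Multiset (Fin (m.size + 1) × ℕ)) :
    m.tokens 0 B = (m.clock, 0) ::ₘ aged B := by
  simp [tokens, aged]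

/-- When a clock of age one is reset, the lead of every other token over it grows by one. -/
theorem tokens_one (B : Multiset (Fin (m.size + 1) × ℕ)) :
    m.tokens 1 B = (m.clock, 1) ::ₘ aged (B.map fun x => (x.1, x.2 + 1)) := by
  simp [tokens, aged, Multiset.map_map, add_comm]

/-- The clock token of `tokens` is unique. -/
theorem clock_unique {a : ℝ≥0} {z : ℕ} {B : Multiset (Fin (m.size + 1) × ℕ)}
    {rest : Marking (Fin (m.size + 1))} (hB : ∀ x ∈ B, x.1 ≠ m.clock)
    (h : m.tokens a B = (m.clock, (z : ℝ≥0)) ::ₘ rest) :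
    a = z ∧ (a = z → rest = B.map fun x => (x.1, (z : ℝ≥0) + x.2)) := by
  have h1 : (m.clock, (z : ℝ≥0)) ∈ m.tokens a B := h ▸ Multiset.mem_cons_self _ _
  rw [tokens, Multiset.mem_cons, Multiset.mem_map] at h1
  have h2 : a = z := by
    rcases h1 with h1 | ⟨x, hx, h1⟩
    · exact (congrArg Prod.snd h1).symm
    · exact absurd (congrArg Prod.fst h1) (hB x hx)
  refine ⟨h2, fun _ => ?_⟩
  rw [tokens, h2, Multiset.cons_inj_right] at h
  exact h.symm

theorem aged_eq_cons {P : Type} {B : Multiset (P × ℕ)} {x : P × ℕ} {rest : Marking P}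
    (h : aged B = (x.1, (x.2 : ℝ≥0)) ::ₘ rest) : ∃ B', B = x ::ₘ B' ∧ rest = aged B' := by
  have h1 : (x.1, (x.2 : ℝ≥0)) ∈ aged B := h ▸ Multiset.mem_cons_self _ _
  obtain ⟨y, hy, h2⟩ := Multiset.mem_map.1 h1
  simp only [Prod.mk.injEq, Nat.cast_inj] at h2
  obtain rfl : y = x := Prod.ext h2.1 h2.2
  obtain ⟨B', rfl⟩ := Multiset.exists_cons_of_mem hy
  rw [aged_cons, Multiset.cons_inj_right] at h
  exact ⟨B', rfl, h.symm⟩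

/-- The configurations that are reachable with input `n`: either the registers are represented
correctly, or some token is too old. -/
def Inv (n : ℕ) (c : Config (Fin m.numControl) (Fin (m.size + 1))) : Prop :=
  c = (m.initial, 0) ∨ ∃ a B, (∀ x ∈ B, x.1 ≠ m.clock) ∧ c.2 = m.tokens a B ∧
    ((∃ q, c.1 = m.main q ∧ ((∃ x ∈ B, 1 ≤ x.2) ∨
      MReach m.prog (m.start, Function.update (fun _ => 0) 0 n) (q, m.content B))) ∨
    (∃ q p, c.1 = m.renew q p ∧ ((∃ x ∈ B, 2 ≤ x.2 ∨ (x.1 = p ∧ 1 ≤ x.2)) ∨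
      MReach m.prog (m.start, Function.update (fun _ => 0) 0 n) (q, m.content B))))

/-- Lets the data of a fired transition be read off from the family in `mem_trans` to which it
belongs. -/
theorem pointTransition_inj {Q P : Type} {q₁ q₁' q₂ q₂' : Q} {A A' : Multiset (P × ℕ)}
    {O O' : Multiset P} (h : pointTransition q₁ q₂ A O = pointTransition q₁' q₂' A' O') :
    q₁ = q₁' ∧ q₂ = q₂' ∧ A = A' ∧ O = O' := by
  simp only [pointTransition, Transition.mk.injEq, true_and] at h
  refine ⟨h.1, h.2.1, Multiset.map_injective ?_ h.2.2.1, Multiset.map_injective ?_ h.2.2.2⟩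
  · rintro ⟨x, i⟩ ⟨y, j⟩ hxy
    simp [Interval.point] at hxy
    simp [hxy]
  · intro x y hxy
    exact congrArg Prod.fst hxy

/-! ### Soundness: cheap runs of the net are honest. -/

/-- Delays change only the clock age `a`. A false test for zero creates a token that is too old, and
no transition removes or renews such a token. Forgetting to renew other tokens does no harm to the
invariant, as `content` counts tokens of all ages. -/
theorem Inv.step {m : Machine} (hm : 0 < m.size) (hb : ∀ e ∈ m.prog, e.2.1.Bounded m.size) {n : ℕ}
    {D : Set ℝ≥0} {c c' : Config (Fin m.numControl) (Fin (m.size + 1))} {r : ℝ}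
    (hc : m.Inv n c) (h : (m.net n).Step D c c' r) : m.Inv n c' := by
  obtain ⟨c1, c2⟩ := c
  obtain ⟨c1', c2'⟩ := c'
  rcases (m.isRefund_net n).step_cases h with ⟨x, h1, _⟩ | ⟨A, O, rest, ht, h1, h2, _⟩
  · cases h1
    rcases hc with h | ⟨a, B, hB, h1, h⟩
    · cases h
      exact .inl rfl
    · dsimp only at h1 ⊢
      subst h1
      exact .inr ⟨a + x, B, hB, m.delay_tokens a x B, h⟩
  · dsimp only at ht h1 h2
    subst h1 h2
    rcases m.mem_trans.1 ht with h | ⟨⟨q, y, q'⟩, hq, h⟩ | ⟨q, p, j, hp, hj, h⟩ | ⟨q, p, h⟩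
    · obtain ⟨rfl, rfl, rfl, rfl⟩ := pointTransition_inj h
      rcases hc with h | ⟨a, B, hB, h1, ⟨q, h, _⟩ | ⟨q, p, h, _⟩⟩
      · have h' := congrArg Prod.snd h
        dsimp only [aged] at h'
        rw [Multiset.map_zero, zero_add] at h'
        subst h'
        refine .inr ⟨0, Multiset.replicate n (m.place 0, 0), ?_, ?_, .inl ⟨m.start, rfl, .inr ?_⟩⟩
        · intro x hx
          rw [Multiset.eq_of_mem_replicate hx]
          exact m.place_ne_clock hm
        · simp [tokens, fresh]
        · rw [m.content_replicate hm]
      · exact absurd h m.initial_ne_main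
      · exact absurd h m.initial_ne_renew
    · have hcase : ∃ a B, (∀ x ∈ B, x.1 ≠ m.clock) ∧ aged A + rest = m.tokens a B ∧
          ((∃ x ∈ B, 1 ≤ x.2) ∨
            MReach m.prog (m.start, Function.update (fun _ => 0) 0 n) (q, m.content B)) := by
        have hs : c1 = m.main q := by
          have := congrArg Transition.source h
          cases y <;> exact this
        rcases hc with h | ⟨a, B, hB, h1, ⟨q, h, h3⟩ | ⟨q, p, h, _⟩⟩
        · exact absurd ((congrArg Prod.fst h).symm.trans hs) m.initial_ne_main
        · rw [m.main_inj.1 (hs.symm.trans h)]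
          exact ⟨a, B, hB, h1, h3⟩
        · exact absurd (hs.symm.trans h) m.main_ne_renew
      obtain ⟨a, B, hB, h1, h3⟩ := hcase
      have hy := hb _ hq
      cases y with
      | nop =>
        obtain ⟨rfl, rfl, rfl, rfl⟩ := pointTransition_inj h
        rw [aged_singleton, Multiset.singleton_add] at h1
        obtain ⟨h4, h5⟩ := m.clock_unique hB h1.symm
        have h5 := h5 h4
        refine .inr ⟨0, B, hB, ?_, .inl ⟨q', rfl, h3.imp id fun h => ?_⟩⟩
        · simp [h5, fresh, tokens]
        · exact h.tail ⟨_, hq, rfl⟩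
      | inc i =>
        obtain ⟨rfl, rfl, rfl, rfl⟩ := pointTransition_inj h
        rw [aged_singleton, Multiset.singleton_add] at h1
        obtain ⟨h4, h5⟩ := m.clock_unique hB h1.symm
        have h5 := h5 h4
        refine .inr ⟨0, (m.place i, 0) ::ₘ B, ?_, ?_, .inl ⟨q', rfl, h3.imp ?_ fun h => ?_⟩⟩
        · intro x hx
          rcases Multiset.mem_cons.1 hx with rfl | hx
          · exact m.place_ne_clock hy
          · exact hB x hx
        · simp [h5, fresh, tokens]
        · rintro ⟨x, hx, h⟩
          exact ⟨x, Multiset.mem_cons_of_mem hx, h⟩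
        · refine h.tail ⟨_, hq, ?_⟩
          simp only [Act.Run, content_cons, m.val_place hy]
      | dec i =>
        obtain ⟨rfl, rfl, rfl, rfl⟩ := pointTransition_inj h
        rw [Multiset.insert_eq_cons, aged_cons, Multiset.cons_add] at h1
        obtain ⟨h4, h5⟩ := m.clock_unique hB h1.symm
        have h5 := h5 h4
        simp only [Nat.cast_zero, zero_add, aged_singleton, Multiset.singleton_add] at h5
        -- The removed token has lead zero, so it is not the one that is too old.
        obtain ⟨B', rfl, h6⟩ := aged_eq_cons (x := (m.place i, 0)) (by simpa [aged] using h5.symm)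
        refine .inr ⟨0, B', fun x hx => hB x (Multiset.mem_cons_of_mem hx), ?_,
          .inl ⟨q', rfl, h3.imp ?_ fun h => ?_⟩⟩
        · simp [h6, fresh, tokens, aged]
        · rintro ⟨x, hx, h⟩
          rcases Multiset.mem_cons.1 hx with rfl | hx
          · simp at h
          · exact ⟨x, hx, h⟩
        · refine h.tail ⟨_, hq, ?_⟩
          simp [Act.Run, content_cons, m.val_place hy]
      | zero i =>
        obtain ⟨rfl, rfl, rfl, rfl⟩ := pointTransition_inj h
        rw [aged_singleton, Multiset.singleton_add] at h1
        obtain ⟨h4, h5⟩ := m.clock_unique hB h1.symm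
        have h5 := h5 h4
        refine .inr ⟨0, B.map fun x => (x.1, x.2 + 1), ?_, ?_, .inr ⟨q', m.place i, rfl, ?_⟩⟩
        · intro x hx
          obtain ⟨y, hy, rfl⟩ := Multiset.mem_map.1 hx
          exact hB y hy
        · simp [h5, fresh, tokens, Multiset.map_map, add_comm]
        · rw [m.content_map (· + 1)]
          rcases h3 with ⟨x, hx, h⟩ | h
          · exact .inl ⟨_, Multiset.mem_map_of_mem _ hx, .inl (by simpa using h)⟩
          -- Either the test is correct and the machine makes the same step, or a token at the
          -- tested place now leads by at least one and cannot be renewed.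
          by_cases h0 : m.content B i = 0
          · exact .inr (h.tail ⟨_, hq, h0, rfl⟩)
          · obtain ⟨x, hx, hxi⟩ := Multiset.countP_pos.1 (Nat.pos_of_ne_zero h0)
            exact .inl ⟨_, Multiset.mem_map_of_mem _ hx, .inr ⟨m.eq_place hxi, by simp⟩⟩
    · obtain ⟨rfl, rfl, rfl, rfl⟩ := pointTransition_inj h
      rcases hc with h | ⟨a, B, hB, h1, ⟨q', h, _⟩ | ⟨q', p', h, h3⟩⟩
      · exact absurd (congrArg Prod.fst h).symm m.initial_ne_renew
      · exact absurd h.symm m.main_ne_renew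
      · obtain ⟨rfl, rfl⟩ := m.renew_inj.1 h
        dsimp only at h1
        rw [Multiset.insert_eq_cons, aged_cons, Multiset.cons_add] at h1
        obtain ⟨h4, h5⟩ := m.clock_unique hB h1.symm
        have h5 := h5 h4
        simp only [Nat.cast_zero, zero_add, aged_singleton, Multiset.singleton_add] at h5
        obtain ⟨B', rfl, h6⟩ := aged_eq_cons (x := (j, 1)) (by simpa [aged] using h5.symm)
        refine .inr ⟨0, (j, 0) ::ₘ B', ?_, ?_, .inr ⟨q, p, rfl, h3.imp ?_ fun h => ?_⟩⟩
        · intro x hx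
          rcases Multiset.mem_cons.1 hx with rfl | hx
          · exact hj
          · exact hB x (Multiset.mem_cons_of_mem hx)
        · simp [h6, fresh, tokens, aged]
        · rintro ⟨x, hx, h⟩
          rcases Multiset.mem_cons.1 hx with rfl | hx
          -- The renewed token leads by one and lies outside of `p`, so it does not witness that a
          -- token is too old.
          · simp [hp] at h
          · exact ⟨x, Multiset.mem_cons_of_mem hx, h⟩
        · rwa [content_cons] at h ⊢
    · obtain ⟨rfl, rfl, rfl, rfl⟩ := pointTransition_inj h
      rcases hc with h | ⟨a, B, hB, h1, ⟨q', h, _⟩ | ⟨q', p', h, h3⟩⟩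
      · exact absurd (congrArg Prod.fst h).symm m.initial_ne_renew
      · exact absurd h.symm m.main_ne_renew
      · obtain ⟨rfl, rfl⟩ := m.renew_inj.1 h
        dsimp only at h1
        rw [aged_singleton, Multiset.singleton_add] at h1
        obtain ⟨h4, h5⟩ := m.clock_unique hB h1.symm
        have h5 := h5 h4
        refine .inr ⟨0, B, hB, ?_, .inl ⟨q, rfl, h3.imp ?_ id⟩⟩
        · simp [h5, fresh, tokens]
        · rintro ⟨x, hx, h⟩
          exact ⟨x, hx, by omega⟩

theorem Inv.computation {m : Machine} (hm : 0 < m.size)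
    (hb : ∀ e ∈ m.prog, e.2.1.Bounded m.size) {n : ℕ}
    {D : Set ℝ≥0} {c c' : Config (Fin m.numControl) (Fin (m.size + 1))} {r : ℝ}
    (h : (m.net n).Computation D c c' r) (hc : m.Inv n c) : m.Inv n c' := by
  induction h with
  | nil => exact hc
  | cons step _ ih => exact ih (hc.step hm hb step)

/-- A cheap computation of the net comes from a computation of the machine. -/
theorem exists_reach_of_costs {m : Machine} (hm : 0 < m.size)
    (hb : ∀ e ∈ m.prog, e.2.1.Bounded m.size) {n : ℕ} {D : Set ℝ≥0} {r : ℝ}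
    (hr : r ∈ (m.net n).costs D m.initial (m.main m.final)) (hr1 : r < 1) :
    ∃ s, MReach m.prog (m.start, Function.update (fun _ => 0) 0 n) (m.final, s) := by
  obtain ⟨M, hM⟩ := hr
  have h1 := (m.isRefund_net n).totalAge_computation hM
  rw [show totalAge (0 : Marking (Fin (m.size + 1))) = 0 by simp [totalAge], zero_add] at h1
  rcases Inv.computation hm hb hM (.inl rfl) with h | ⟨a, B, hB, h2, ⟨q, h, h3⟩ | ⟨q, p, h, _⟩⟩
  · exact absurd (congrArg Prod.fst h).symm m.initial_ne_main
  · rcases h3 with ⟨x, hx, hx1⟩ | h3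
    -- A token that leads the clock by at least one has age at least one, so the total age, which is
    -- the cost, is not below one.
    · obtain ⟨B', rfl⟩ := Multiset.exists_cons_of_mem hx
      dsimp only at h1 h2
      have h4 : totalAge M = a + ((a + x.2 : ℝ≥0) : ℝ) +
          totalAge (B'.map fun x => (x.1, a + (x.2 : ℝ≥0))) := by
        simp [h2, tokens, totalAge, add_assoc]
      have h5 := totalAge_nonneg (B'.map fun x => (x.1, a + (x.2 : ℝ≥0)))
      have h6 : (1 : ℝ) ≤ x.2 := by exact_mod_cast hx1
      have h7 : (0 : ℝ) ≤ a := a.2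
      push_cast at h4
      linarith
    · rw [m.main_inj.1 h]
      exact ⟨_, h3⟩
  · exact absurd h m.main_ne_renew

/-! ### Completeness: honest runs end with all ages zero. -/

/-- Tokens are renewed one by one, without delay; `B'` collects those already renewed and therefore
varies in the induction. -/
theorem reach_renew {m : Machine} {n : ℕ} {D : Set ℝ≥0} (h0 : 0 ∈ D) (q : m.State)
    (p : Fin (m.size + 1)) (B : Multiset (Fin (m.size + 1) × ℕ))
    (hB : ∀ x ∈ B, x.1 ≠ m.clock ∧ x.1 ≠ p ∧ x.2 = 0) (B' : Multiset (Fin (m.size + 1) × ℕ)) :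
    (m.net n).Reach D (m.renew q p, m.tokens 0 (B.map (fun x => (x.1, x.2 + 1)) + B'))
      (m.renew q p, m.tokens 0 (B + B')) := by
  induction B using Multiset.induction generalizing B' with
  | empty => simpa using Relation.ReflTransGen.refl
  | cons x B ih =>
    obtain ⟨j, y⟩ := x
    obtain ⟨h1, h2, rfl⟩ := hB _ (Multiset.mem_cons_self _ _)
    have h3 := ih (fun x hx => hB x (Multiset.mem_cons_of_mem hx)) ((j, 0) ::ₘ B')
    rw [Multiset.add_cons, Multiset.add_cons] at h3
    refine .trans ?_ (by simpa only [Multiset.cons_add] using h3)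
    have h4 := Net.reach_fire (N := m.net n) h0 (m.mem_trans.2 (.inr (.inr (.inl
      ⟨q, p, j, h2, h1, rfl⟩)))) (aged (B.map (fun x => (x.1, x.2 + 1)) + B'))
    simpa [tokens, fresh, aged] using h4

/-- After every simulated instruction all ages are zero. A correct test for zero waits one unit and
then renews all register tokens, which is possible because none lies at the tested place. -/
theorem reach_of_reach {m : Machine} (hm : 0 < m.size)
    (hb : ∀ e ∈ m.prog, e.2.1.Bounded m.size) {n : ℕ} {D : Set ℝ≥0} (h0 : 0 ∈ D) (h1 : 1 ∈ D)
    {c : m.State × (ℕ → ℕ)}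
    (h : MReach m.prog (m.start, Function.update (fun _ => 0) 0 n) c) :
    ∃ B, (∀ x ∈ B, x.1 ≠ m.clock ∧ x.2 = 0) ∧ m.content B = c.2 ∧
      (m.net n).Reach D (m.initial, 0) (m.main c.1, m.tokens 0 B) := by
  induction h with
  | refl =>
    refine ⟨Multiset.replicate n (m.place 0, 0), ?_, m.content_replicate hm n, ?_⟩
    · intro x hx
      rw [Multiset.eq_of_mem_replicate hx]
      exact ⟨m.place_ne_clock hm, rfl⟩
    · have h4 := Net.reach_fire (N := m.net n) h0 (m.mem_trans.2 (.inl rfl)) 0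
      simpa [tokens, fresh, aged] using h4
  | @tail c c' _ hs ih =>
    obtain ⟨B, hB, hBc, hr⟩ := ih
    obtain ⟨q, s⟩ := c
    obtain ⟨q', s'⟩ := c'
    obtain ⟨y, hy, hrun⟩ := hs
    dsimp only at hBc hy hrun hr ⊢
    subst hBc
    have ht := (m.mem_trans (n := n)).2 (.inr (.inl ⟨_, hy, rfl⟩))
    have hyb := hb _ hy
    cases y with
    | nop =>
      have h4 := Net.reach_fire h0 ht (aged B)
      refine ⟨B, hB, hrun.symm, hr.trans ?_⟩
      simpa [tokens, fresh, aged] using h4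
    | inc i =>
      have h4 := Net.reach_fire h0 ht (aged B)
      refine ⟨(m.place i, 0) ::ₘ B, ?_, ?_, hr.trans ?_⟩
      · intro x hx
        rcases Multiset.mem_cons.1 hx with rfl | hx
        · exact ⟨m.place_ne_clock hyb, rfl⟩
        · exact hB x hx
      · rw [content_cons, m.val_place hyb]
        exact hrun.symm
      · simpa [tokens, fresh, aged] using h4
    | dec i =>
      obtain ⟨⟨p, z⟩, hx, hxi⟩ := Multiset.countP_pos.1 (Nat.pos_of_ne_zero hrun.1)
      obtain rfl := m.eq_place hxi
      obtain rfl := (hB _ hx).2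
      obtain ⟨B', rfl⟩ := Multiset.exists_cons_of_mem hx
      have h4 := Net.reach_fire h0 ht (aged B')
      refine ⟨B', fun x hx => hB x (Multiset.mem_cons_of_mem hx), ?_, hr.trans ?_⟩
      · rw [hrun.2, content_cons, m.val_place hyb]
        simp
      · simpa [tokens, fresh, aged] using h4
    | zero i =>
      obtain ⟨hz, rfl⟩ := hrun
      have hBi : ∀ x ∈ B, x.1 ≠ m.clock ∧ x.1 ≠ m.place i ∧ x.2 = 0 := by
        intro x hx
        refine ⟨(hB x hx).1, fun h => ?_, (hB x hx).2⟩
        refine Multiset.countP_eq_zero.1 hz x hx ?_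
        rw [h, m.val_place hyb]
      refine ⟨B, hB, rfl, hr.trans ?_⟩
      have h2 := Net.Step.time (N := m.net n) (D := D) (m.main q) (m.tokens 0 B) 1 one_pos h1
      rw [delay_tokens, zero_add] at h2
      have h3 := Net.reach_fire h0 ht (aged (B.map fun x => (x.1, x.2 + 1)))
      have h4 := reach_renew (n := n) h0 q' (m.place i) B hBi 0
      have h5 := Net.reach_fire h0 ((m.mem_trans (n := n)).2 (.inr (.inr (.inr
        ⟨q', m.place i, rfl⟩)))) (aged B)
      rw [add_zero, add_zero] at h4
      rw [aged_singleton, fresh_singleton, Multiset.singleton_add, Multiset.singleton_add] at h3 h5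
      simp only [Nat.cast_zero, Nat.cast_one, ← tokens_zero, ← tokens_one] at h3 h5
      exact .head ⟨_, h2⟩ ((h3.trans h4).trans h5)

/-- A computation of the machine is simulated at cost zero. -/
theorem zero_mem_costs {m : Machine} (hm : 0 < m.size)
    (hb : ∀ e ∈ m.prog, e.2.1.Bounded m.size) {n : ℕ} {D : Set ℝ≥0} (h0 : 0 ∈ D) (h1 : 1 ∈ D)
    {s : ℕ → ℕ}
    (h : MReach m.prog (m.start, Function.update (fun _ => 0) 0 n) (m.final, s)) :
    (0 : ℝ) ∈ (m.net n).costs D m.initial (m.main m.final) := by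
  obtain ⟨B, hB, _, hr⟩ := reach_of_reach hm hb h0 h1 h
  obtain ⟨r, hr⟩ := Net.exists_computation hr
  refine ⟨m.tokens 0 B, ?_⟩
  have h2 := (m.isRefund_net n).totalAge_computation hr
  rw [show totalAge (0 : Marking (Fin (m.size + 1))) = 0 by simp [totalAge], zero_add] at h2
  have h3 : totalAge (m.tokens 0 B) = 0 := by
    refine Multiset.sum_eq_zero fun x hx => ?_
    obtain ⟨y, hy, rfl⟩ := Multiset.mem_map.1 hx
    rcases Multiset.mem_cons.1 hy with rfl | hy
    · rfl
    · obtain ⟨z, hz, rfl⟩ := Multiset.mem_map.1 hy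
      simp [(hB z hz).2]
  rw [← h2] at hr
  rwa [h3] at hr

end Machine

/-! ## The reduction -/

/-- A code of a transition, with the refund of the consumed ages as its cost. -/
noncomputable def Transition.code {a b : ℕ} (t : Transition (Fin a) (Fin b)) : TransitionCode :=
  (t.source.val, t.target.val, (t.input.map (Prod.map Fin.val id)).toList,
    (t.read.map (Prod.map Fin.val id)).toList, (t.output.map (Prod.map Fin.val id)).toList,
    inputCost t)

theorem Transition.transition_code {a b : ℕ} (t : Transition (Fin a) (Fin b)) :
    t.code.transition = t.map Fin.val Fin.val := by
  simp [Transition.code, TransitionCode.transition, Transition.map]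

theorem inputCost_map {Q P Q' P' : Type} (f : Q → Q') (g : P → P') (t : Transition Q P) :
    inputCost (t.map f g) = inputCost t := by
  simp [inputCost, Transition.map, Multiset.map_map]

namespace Machine

variable (m : Machine)

/-- The instance for the input `n`. -/
noncomputable def toInstance (n : ℕ) : Instance where
  numStates := m.numControl
  numPlaces := m.size + 1
  net := m.net n
  init := m.initial
  fin := m.main m.final
  threshold := 0

theorem inputCost_nonpos {Q P : Type} (t : Transition Q P) : inputCost t ≤ 0 := by
  rw [inputCost, neg_nonpos]
  refine Multiset.sum_nonneg fun x hx => ?_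
  obtain ⟨y, _, rfl⟩ := Multiset.mem_map.1 hx
  exact Int.natCast_nonneg _

theorem toInstance_mem_restricted (n : ℕ) : m.toInstance n ∈ restricted :=
  ⟨fun _ => zero_le_one, fun _ => inputCost_nonpos _, rfl⟩

/-- The code of the transition that sets register zero to `n`. -/
noncomputable def loadCode (n : ℕ) : TransitionCode :=
  (m.initial.val, (m.main m.start).val, [], [], (m.clock.val, .point 0) ::
    (List.range n).map fun _ => ((m.place 0).val, .point 0), 0)

theorem transition_loadCode (n : ℕ) :
    (m.loadCode n).transition = (m.load n).map Fin.val Fin.val := by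
  simp [loadCode, TransitionCode.transition, Transition.map, load, pointTransition,
    Multiset.map_replicate]
  rfl

/-- The code of the instance for the input `n`. -/
noncomputable def code (n : ℕ) : InstanceCode :=
  (m.numControl, List.replicate (m.size + 1) 1,
    m.loadCode n :: m.fixedTrans_finite.toFinset.toList.map Transition.code,
    m.initial.val, (m.main m.final).val, 0)

theorem represents_code (n : ℕ) : Represents (m.code n) (m.toInstance n) := by
  refine ⟨rfl, ?_, ?_, ?_, rfl, rfl, rfl⟩
  · exact (List.ofFn_const _ _).symm
  · change _ = Multiset.map (Transition.map (Fin.val (n := m.numControl))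
      (Fin.val (n := m.size + 1))) (m.load n ::ₘ m.fixedTrans_finite.toFinset.val)
    rw [Multiset.map_cons, List.map_cons, List.map_map, ← Multiset.cons_coe, transition_loadCode]
    congr 1
    rw [← Multiset.map_coe, Finset.coe_toList]
    exact Multiset.map_congr rfl fun t _ => t.transition_code
  · have key : ∀ e ∈ m.loadCode n :: m.fixedTrans_finite.toFinset.toList.map Transition.code,
        e.cost = inputCost e.transition := by
      intro e he
      rcases List.mem_cons.1 he with rfl | he
      · rfl
      · obtain ⟨t, _, rfl⟩ := List.mem_map.1 he
        rw [Transition.transition_code, inputCost_map]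
        rfl
    intro e he t h
    rw [key e he, h, inputCost_map]
    rfl

/-- Only `loadCode` depends on `n`. All other entries are constants, so it does not matter that they
come from choice. -/
theorem computable_code : Computable m.code := by
  have h1 : Primrec m.loadCode :=
    .pair (.const _) (.pair (.const _) (.pair (.const _) (.pair (.const _) (.pair
      (Primrec.list_cons.comp (.const _) (Primrec.list_map Primrec.list_range
        (Primrec.const _).to₂)) (.const _)))))
  have h2 : Primrec m.code :=
    .pair (.const _) (.pair (.const _) (.pair (Primrec.list_cons.comp h1 (.const _)) (.const _)))
  exact h2.to_comp

end Machine

/-- A problem is undecidable if zero cost is sufficient for it and cost below one is necessary. -/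
theorem not_decidableOn {C : Set Instance} (hC : restricted ⊆ C) {D : Set ℝ≥0} (h0 : 0 ∈ D)
    (h1 : 1 ∈ D) (A : Instance → Prop)
    (hA : ∀ I : Instance, I.threshold = 0 → (0 : ℝ) ∈ I.net.costs D I.init I.fin → A I)
    (hA' : ∀ I : Instance, I.threshold = 0 → A I → ∃ r ∈ I.net.costs D I.init I.fin, r < 1) :
    ¬ DecidableOn C A := by
  rintro ⟨f, hf, h⟩
  obtain ⟨m, hm, hb, hhalt⟩ := exists_halting_machine
  refine ComputablePred.halting_problem 0 ?_
  rw [ComputablePred.computable_iff]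
  refine ⟨fun c => f (m.code (Encodable.encode c)),
    hf.comp (m.computable_code.comp Computable.encode), funext fun c => propext ?_⟩
  rw [hhalt c, h _ (hC (m.toInstance_mem_restricted _)) _ (m.represents_code _)]
  constructor
  · rintro ⟨s, hs⟩
    exact hA _ rfl (Machine.zero_mem_costs hm hb h0 h1 hs)
  · intro hI
    obtain ⟨r, hr, hr1⟩ := hA' _ rfl hI
    exact Machine.exists_reach_of_costs hm hb hr hr1

theorem not_decidableOn_costThreshold {C : Set Instance} (hC : restricted ⊆ C) {D : Set ℝ≥0}
    (h0 : 0 ∈ D) (h1 : 1 ∈ D) : ¬ DecidableOn C (CostThreshold D) := by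
  refine not_decidableOn hC h0 h1 _ (fun I hI h => ?_) fun I hI h => ?_
  · refine sInf_le ⟨0, h, ?_⟩
    simp [hI]
  -- The infimum need not be attained, but being below one it is undercut by an actual computation
  -- of cost below one.
  · have h2 : I.net.optCost D I.init I.fin < ((1 : ℝ) : EReal) :=
      lt_of_le_of_lt h (by rw [hI]; exact_mod_cast one_pos)
    obtain ⟨_, ⟨r, hr, rfl⟩, hr1⟩ := sInf_lt_iff.1 h2
    exact ⟨r, hr, EReal.coe_lt_coe_iff.1 hr1⟩

theorem not_decidableOn_zeroCostReachable {C : Set Instance} (hC : restricted ⊆ C) {D : Set ℝ≥0}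
    (h0 : 0 ∈ D) (h1 : 1 ∈ D) : ¬ DecidableOn C (ZeroCostReachable D) :=
  not_decidableOn hC h0 h1 _ (fun _ _ h => h) fun _ _ h => ⟨0, h, one_pos⟩

end PTPN

theorem mainTheorem2 (C : Set PTPN.Instance) (hC : PTPN.restricted ⊆ C) :
    ¬ PTPN.DecidableOn C (PTPN.CostThreshold PTPN.denseTime) ∧
    ¬ PTPN.DecidableOn C (PTPN.ZeroCostReachable PTPN.denseTime) ∧
    ¬ PTPN.DecidableOn C (PTPN.CostThreshold PTPN.discreteTime) ∧
    ¬ PTPN.DecidableOn C (PTPN.ZeroCostReachable PTPN.discreteTime) := by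
  have h0 : (0 : ℝ≥0) ∈ PTPN.discreteTime := ⟨0, Nat.cast_zero⟩
  have h1 : (1 : ℝ≥0) ∈ PTPN.discreteTime := ⟨1, Nat.cast_one⟩
  exact ⟨PTPN.not_decidableOn_costThreshold hC trivial trivial,
    PTPN.not_decidableOn_zeroCostReachable hC trivial trivial,
    PTPN.not_decidableOn_costThreshold hC h0 h1,
    PTPN.not_decidableOn_zeroCostReachable hC h0 h1⟩
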